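/- Let $\phi_{\Sigma}(x-\mu)=(2\pi)^{-d/2}|\Sigma|^{-1/2}\exp\left(-\tfrac12 (x-\mu)^T\Sigma^{-1}(x-\mu)\right)$ denote the $N_d(\mu,\Sigma)$ density, where $\mu\in\mathbb{R}^d$ and $\Sigma$ is a (symmetric) positive definite $d\times d$ matrix. A function $g:\mathbb{R}^d\to[0,\infty)$ is called log-concave if $g=e^{-\varphi}$ for some convex $\varphi:\mathbb{R}^d\to(-\infty,\infty]$. A probability density $p$ on $\mathbb{R}^d$ (with respect to Lebesgue measure) belongs to $SLC_2(\mu,\Sigma,d)$ if $p(x)=g(x)\,\phi_\Sigma(x-\mu)$ for all $x\in\mathbb{R}^d$ and some log-concave function $g$. More generally, an integrable function $h:\mathbb{R}^d\to[0,\infty)$ that need not be a probability density is said to belong to $SLC_2(\mu,\Sigma)$ if $h(x)=g(x)\,\phi_\Sigma(x-\mu)$ for all $x$ and some log-concave $g$. **Theorem (Preservation of strong log-concavity).** (a) (Linear transformations) Suppose that $X$ has density $p\in SLC_2(0,\Sigma,d)$ and let $A$ be a nonsingular $d\times d$ matrix. Then $Y=AX$ has density $q\in SLC_2(0,A\Sigma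 A^T,d)$ given by $q(y)=p(A^{-1}y)\,|\det(A^{-1})|$. (b) (Convolution) If $X\sim p\in SLC_2(0,\Sigma,d)$ and $Y\sim q\in SLC_2(0,\Gamma,d)$ are independent, then the integral $(p\star q)(z)=\int_{\mathbb{R}^d}p(x)q(z-x)\,dx$ converges for every $z$, and $Z=X+Y$ has density $p\star q\in SLC_2(0,\Sigma+\Gamma,d)$. (c) (Product distribution) If $X\sim p\in SLC_2(0,\Sigma,m)$ and $Y\sim q\in SLC_2(0,\Gamma,n)$ are independent, then $(X,Y)$ has density $$(x,y)\mapsto p(x)q(y)\ \in\ SLC_2\left(0,\begin{pmatrix}\Sigma&0\\0&\Gamma\end{pmatrix},m+n\right).$$ (d) (Product function) If $p\in SLC_2(0,\Sigma,d)$ and $q\in SLC_2(0,\Gamma,d)$, then $h(x)=p(x)q(x)$ (which is typically not a probability density) is integrable and belongs to $SLC_2\left(0,(\Sigma^{-1}+\Gamma^{-1})^{-1}\right)$. -/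

import Mathlib

open MeasureTheory ProbabilityTheory
open scoped Convolution Matrix

/-- A function `f : ℝ^ι → [0, ∞)` is log-concave if `f = exp (-φ)` for some convex function
`φ : ℝ^ι → (-∞, ∞]`, where `exp (-∞) = 0` (the value of `f` where `φ = ∞`). -/
def IsLogConcave {ι : Type*} (f : (ι → ℝ) → ℝ) : Prop :=
  ∃ φ : (ι → ℝ) → EReal,
    (∀ x, φ x ≠ ⊥) ∧
    (∀ x y : ι → ℝ, ∀ a b : ℝ, 0 < a → 0 < b → a + b = 1 →
      φ (a • x + b • y) ≤ (a : EReal) * φ x + (b : EReal) * φ y) ∧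
    ∀ x, f x = (EReal.exp (-φ x)).toReal

/-- The density `φ_S (x - μ)` of the normal distribution on `ℝ^ι` with mean `μ` and positive
definite covariance matrix `S`, where `ι` has `d` elements:
`(2π)^(-d/2) |S|^(-1/2) exp (-(x - μ)ᵀ S⁻¹ (x - μ) / 2)`. -/
noncomputable def gaussianDensity {ι : Type*} [Fintype ι] [DecidableEq ι]
    (μ : ι → ℝ) (S : Matrix ι ι ℝ) (x : ι → ℝ) : ℝ :=
  (Real.sqrt ((2 * Real.pi) ^ Fintype.card ι * S.det))⁻¹ *
    Real.exp (-(1 / 2) * ((x - μ) ⬝ᵥ (S⁻¹ *ᵥ (x - μ))))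

/-- The strongly log-concave functions with parameters `μ` and `S` (a positive definite matrix),
not necessarily normalized to be probability densities: the measurable, integrable functions
of the form `x ↦ g x * φ_S (x - μ)` with `g` log-concave (and so nonnegative). -/
def SLC2Fun {ι : Type*} [Fintype ι] [DecidableEq ι] (μ : ι → ℝ) (S : Matrix ι ι ℝ) :
    Set ((ι → ℝ) → ℝ) :=
  {f | S.PosDef ∧ Measurable f ∧ Integrable f volume ∧
    ∃ g : (ι → ℝ) → ℝ, IsLogConcave g ∧ ∀ x, f x = g x * gaussianDensity μ S x}

/-- The class `SLC_2(μ, S, d)`, `d = |ι|`, of strongly log-concave probability densities with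
respect to Lebesgue measure on `ℝ^ι`. -/
def SLC2 {ι : Type*} [Fintype ι] [DecidableEq ι] (μ : ι → ℝ) (S : Matrix ι ι ℝ) :
    Set ((ι → ℝ) → ℝ) :=
  {p | p ∈ SLC2Fun μ S ∧ ∫ x, p x = 1}

/-- The random vector `X` has density `p` with respect to Lebesgue measure on `ℝ^ι`. -/
def HasDensity {Ω ι : Type*} [Fintype ι] [MeasurableSpace Ω]
    (X : Ω → ι → ℝ) (P : Measure Ω) (p : (ι → ℝ) → ℝ) : Prop :=
  HasLaw X (volume.withDensity fun x => ENNReal.ofReal (p x)) P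

/-!
The classes are governed by one inequality. Since a Gaussian density `φ_S` satisfies
`φ_S(x)^a φ_S(y)^b exp (ab/2 * Q_S(x - y)) = φ_S(ax + by)` for `a + b = 1`, where `Q_S(x) = xᵀ S⁻¹ x`
(`gaussianDensity_rpow_mul_rpow`), a function `f` is a log-concave multiple of `φ_S` if and only if
`f ≥ 0` and `f(x)^a f(y)^b exp (ab/2 * Q_S(x - y)) ≤ f(ax + by)`
(`exists_isLogConcave_mul_gaussianDensity_iff`). In this form the normalizing constants disappear,
and linear maps, products of distributions and pointwise products amount to an identity between
quadratic forms.

For convolutions, `Q_{S+T}(x + y) ≤ Q_S(x) + Q_T(y)` (`precisionForm_add_le`) lets the factor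
`exp (ab/2 * Q_{S+T}(z - w))` be taken out of the integral, and the Prékopa–Leindler inequality
(`prekopaLeindler_pi`) does the rest. That inequality is proved on the line from the one-dimensional
Brunn–Minkowski inequality applied to superlevel sets, and then passes to products. The convolution
integral converges everywhere, and the pointwise product is integrable, because a strongly
log-concave density is bounded (`StronglyLogConcave.exists_forall_le`).

The statements about laws are identities between the measures with the given densities; that the
new densities have total mass one follows from the same identities.
-/

section PreservationProof

open scoped ENNReal Pointwise

/-! ### The Prékopa–Leindler inequality -/

/-- The translates `K + min L` and `max K + L` both lie in `K + L` and meet in at most one point. -/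
theorem Real.volume_add_volume_le_of_isCompact {K L : Set ℝ} (hK : IsCompact K) (hL : IsCompact L)
    (hKne : K.Nonempty) (hLne : L.Nonempty) : volume K + volume L ≤ volume (K + L) := by
  obtain ⟨m, hmK, hm⟩ := hK.exists_isGreatest hKne
  obtain ⟨l, hlL, hl⟩ := hL.exists_isLeast hLne
  have hL' : MeasurableSet ((fun y => m + y) '' L) :=
    (hL.image (continuous_const.add continuous_id)).measurableSet
  have hinter : volume ((fun x => x + l) '' K ∩ (fun y => m + y) '' L) = 0 := by
    refine measure_mono_null (t := {m + l}) ?_ (by simp)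
    rintro z ⟨⟨x, hx, rfl⟩, y, hy, hxy⟩
    have h1 := hm hx
    have h2 := hl hy
    simp only [Set.mem_singleton_iff] at *
    linarith
  calc volume K + volume L
      = volume ((fun x => x + l) '' K) + volume ((fun y => m + y) '' L) := by simp
    _ = volume ((fun x => x + l) '' K ∪ (fun y => m + y) '' L) := by
      rw [← measure_union_add_inter _ hL', hinter, add_zero]
    _ ≤ volume (K + L) := by
      refine measure_mono ?_
      rintro z (⟨x, hx, rfl⟩ | ⟨y, hy, rfl⟩)
      · exact Set.add_mem_add hx hlL
      · exact Set.add_mem_add hmK hy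

/-- The Brunn–Minkowski inequality on the line, reduced to compact sets by inner regularity. -/
theorem Real.volume_add_volume_le {A B : Set ℝ} (hA : MeasurableSet A) (hB : MeasurableSet B)
    (hAne : A.Nonempty) (hBne : B.Nonempty) : volume A + volume B ≤ volume (A + B) := by
  obtain ⟨a, ha⟩ := hAne
  obtain ⟨b, hb⟩ := hBne
  -- Adjoining `a` to `K` and `b` to `L` makes both compact sets nonempty.
  have key : ∀ K ⊆ A, IsCompact K → ∀ L ⊆ B, IsCompact L →
      volume K + volume L ≤ volume (A + B) := by
    intro K hKA hK L hLB hL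
    calc volume K + volume L ≤ volume (insert a K) + volume (insert b L) := by
          gcongr <;> exact Set.subset_insert _ _
      _ ≤ volume (insert a K + insert b L) :=
          Real.volume_add_volume_le_of_isCompact (hK.insert a) (hL.insert b)
            (Set.insert_nonempty _ _) (Set.insert_nonempty _ _)
      _ ≤ volume (A + B) := measure_mono
          (Set.add_subset_add (Set.insert_subset ha hKA) (Set.insert_subset hb hLB))
  rw [hA.measure_eq_iSup_isCompact, hB.measure_eq_iSup_isCompact]
  simp only [iSup_and']
  exact ENNReal.biSup_add_biSup_le' ⟨∅, by simp⟩ ⟨∅, by simp⟩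
    fun K hK L hL => key K hK.1 hK.2 L hL.1 hL.2

/-- Layer-cake formula for a function with values in `[0, 1]`. -/
theorem lintegral_eq_lintegral_Ioo_meas_lt {f : ℝ → ℝ≥0∞} (hf : Measurable f)
    (hf1 : ∀ x, f x ≤ 1) :
    ∫⁻ x, f x = ∫⁻ t in Set.Ioo (0 : ℝ) 1, volume {x | ENNReal.ofReal t < f x} := by
  have hne : ∀ x, f x ≠ ⊤ := fun x => ((hf1 x).trans_lt ENNReal.one_lt_top).ne
  have h1 : ∫⁻ x, f x = ∫⁻ t in Set.Ioi (0 : ℝ), volume {x | ENNReal.ofReal t < f x} := by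
    rw [← lintegral_congr fun x => ENNReal.ofReal_toReal (hne x),
      lintegral_eq_lintegral_meas_lt volume (ae_of_all _ fun x => ENNReal.toReal_nonneg)
        hf.ennreal_toReal.aemeasurable]
    refine setLIntegral_congr_fun measurableSet_Ioi fun t ht => ?_
    simp only [ENNReal.ofReal_lt_iff_lt_toReal (le_of_lt ht) (hne _)]
  have h2 : ∀ t : ℝ, volume {x | ENNReal.ofReal t < f x} =
      (Set.Iio (1 : ℝ)).indicator (fun t => volume {x | ENNReal.ofReal t < f x}) t := by
    intro t
    by_cases ht : t < 1
    · simp [ht]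
    · have : {x | ENNReal.ofReal t < f x} = ∅ := by
        ext x
        simpa using (hf1 x).trans (ENNReal.one_le_ofReal.2 (not_lt.1 ht))
      simp [ht, this]
  rw [h1, lintegral_congr h2, setLIntegral_indicator measurableSet_Iio, Set.inter_comm,
    Set.Ioi_inter_Iio]

/-- The Prékopa–Leindler inequality on the line for functions of supremum `1`, in its stronger additive
form: at each height `t < 1` the superlevel sets satisfy `a {f > t} + b {g > t} ⊆ {h > t}`, with both
sets on the left nonempty, so Brunn–Minkowski applies height by height. -/
theorem lintegral_add_lintegral_le_of_rpow_mul_rpow_le {a b : ℝ} (ha : 0 < a) (hb : 0 < b)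
    (hab : a + b = 1) {f g h : ℝ → ℝ≥0∞} (hf : Measurable f) (hg : Measurable g)
    (hh : Measurable h) (hf1 : (⨆ x, f x) = 1) (hg1 : (⨆ x, g x) = 1)
    (H : ∀ x y, f x ^ a * g y ^ b ≤ h (a * x + b * y)) :
    ENNReal.ofReal a * (∫⁻ x, f x) + ENNReal.ofReal b * (∫⁻ x, g x) ≤ ∫⁻ x, h x := by
  have hfle : ∀ x, f x ≤ 1 := fun x => hf1 ▸ le_iSup f x
  have hgle : ∀ x, g x ≤ 1 := fun x => hg1 ▸ le_iSup g x
  have hmeas : ∀ u : ℝ → ℝ≥0∞, Measurable fun t : ℝ => volume {x | ENNReal.ofReal t < u x} := by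
    refine fun u => Antitone.measurable fun s t hst => measure_mono fun x hx => ?_
    exact (ENNReal.ofReal_le_ofReal hst).trans_lt hx
  calc ENNReal.ofReal a * (∫⁻ x, f x) + ENNReal.ofReal b * (∫⁻ x, g x)
      = ∫⁻ t in Set.Ioo (0 : ℝ) 1, (ENNReal.ofReal a * volume {x | ENNReal.ofReal t < f x} +
          ENNReal.ofReal b * volume {x | ENNReal.ofReal t < g x}) := by
        rw [lintegral_add_left ((hmeas f).const_mul _), lintegral_const_mul _ (hmeas f),
          lintegral_const_mul _ (hmeas g), lintegral_eq_lintegral_Ioo_meas_lt hf hfle,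
          lintegral_eq_lintegral_Ioo_meas_lt hg hgle]
    -- `h` may be unbounded; capping it at `1` leaves its superlevel sets of height `< 1` unchanged.
    _ ≤ ∫⁻ t in Set.Ioo (0 : ℝ) 1, volume {x | ENNReal.ofReal t < min (h x) 1} := by
        refine setLIntegral_mono (hmeas _) fun t ht => ?_
        have ht1 : ENNReal.ofReal t < 1 := by simpa using ht.2
        obtain ⟨x₀, hx₀⟩ := lt_iSup_iff.1 (hf1 ▸ ht1)
        obtain ⟨y₀, hy₀⟩ := lt_iSup_iff.1 (hg1 ▸ ht1)
        have hA := Measure.addHaar_smul (volume : Measure ℝ) a {x | ENNReal.ofReal t < f x}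
        have hB := Measure.addHaar_smul (volume : Measure ℝ) b {x | ENNReal.ofReal t < g x}
        simp only [Module.finrank_self, pow_one, abs_of_pos ha, abs_of_pos hb] at hA hB
        rw [← hA, ← hB]
        refine (Real.volume_add_volume_le
          ((measurableSet_lt measurable_const hf).const_smul₀ a)
          ((measurableSet_lt measurable_const hg).const_smul₀ b)
          (Set.Nonempty.smul_set ⟨x₀, hx₀⟩) (Set.Nonempty.smul_set ⟨y₀, hy₀⟩)).trans
          (measure_mono ?_)
        rintro _ ⟨_, ⟨x, hx, rfl⟩, _, ⟨y, hy, rfl⟩, rfl⟩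
        refine lt_min (lt_of_lt_of_le ?_ (H x y)) ht1
        calc ENNReal.ofReal t = ENNReal.ofReal t ^ a * ENNReal.ofReal t ^ b := by
              rw [← ENNReal.rpow_add_of_nonneg _ _ ha.le hb.le, hab, ENNReal.rpow_one]
          _ < f x ^ a * g y ^ b :=
              ENNReal.mul_lt_mul (ENNReal.rpow_lt_rpow hx ha) (ENNReal.rpow_lt_rpow hy hb)
    _ = ∫⁻ x, min (h x) 1 :=
        (lintegral_eq_lintegral_Ioo_meas_lt (hh.min measurable_const)
          fun x => min_le_right _ _).symm
    _ ≤ ∫⁻ x, h x := lintegral_mono fun x => min_le_left _ _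

/-- Weighted arithmetic-geometric mean inequality in `[0, ∞]`. -/
theorem ENNReal.rpow_mul_rpow_le_add {a b : ℝ} (ha : 0 < a) (hb : 0 < b) (hab : a + b = 1)
    (u v : ℝ≥0∞) : u ^ a * v ^ b ≤ ENNReal.ofReal a * u + ENNReal.ofReal b * v := by
  rcases eq_or_ne u ⊤ with rfl | hu
  · simp [ENNReal.mul_top, ha]
  rcases eq_or_ne v ⊤ with rfl | hv
  · simp [ENNReal.mul_top, hb]
  have := Real.geom_mean_le_arith_mean2_weighted ha.le hb.le u.toReal_nonneg v.toReal_nonneg hab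
  rw [← ENNReal.ofReal_toReal hu, ← ENNReal.ofReal_toReal hv,
    ENNReal.ofReal_rpow_of_nonneg u.toReal_nonneg ha.le,
    ENNReal.ofReal_rpow_of_nonneg v.toReal_nonneg hb.le, ← ENNReal.ofReal_mul (by positivity),
    ← ENNReal.ofReal_mul ha.le, ← ENNReal.ofReal_mul hb.le,
    ← ENNReal.ofReal_add (by positivity) (by positivity)]
  exact ENNReal.ofReal_le_ofReal this

/-- The Prékopa–Leindler inequality on the line for bounded `f` and `g`: dividing them by their suprema
reduces it to the additive form, and the arithmetic-geometric mean inequality returns to products. -/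
theorem lintegral_rpow_mul_lintegral_rpow_le_of_iSup_ne_top {a b : ℝ} (ha : 0 < a) (hb : 0 < b)
    (hab : a + b = 1) {f g h : ℝ → ℝ≥0∞} (hf : Measurable f) (hg : Measurable g)
    (hh : Measurable h) (hft : (⨆ x, f x) ≠ ⊤) (hgt : (⨆ x, g x) ≠ ⊤)
    (H : ∀ x y, f x ^ a * g y ^ b ≤ h (a * x + b * y)) :
    (∫⁻ x, f x) ^ a * (∫⁻ x, g x) ^ b ≤ ∫⁻ x, h x := by
  set c := ⨆ x, f x with hc
  set d := ⨆ x, g x with hd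
  rcases eq_or_ne c 0 with hc0 | hc0
  · have : ∀ x, f x = 0 := fun x => le_antisymm (hc0 ▸ le_iSup f x) zero_le
    simp [this, ha]
  rcases eq_or_ne d 0 with hd0 | hd0
  · have : ∀ x, g x = 0 := fun x => le_antisymm (hd0 ▸ le_iSup g x) zero_le
    simp [this, hb]
  have hca0 : c ^ a ≠ 0 := by simp [ENNReal.rpow_eq_zero_iff, hc0, hft, ha]
  have hcat : c ^ a ≠ ⊤ := ENNReal.rpow_ne_top_of_nonneg ha.le hft
  have hdb0 : d ^ b ≠ 0 := by simp [ENNReal.rpow_eq_zero_iff, hd0, hgt, hb]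
  have hdbt : d ^ b ≠ ⊤ := ENNReal.rpow_ne_top_of_nonneg hb.le hgt
  have hk0 : c ^ a * d ^ b ≠ 0 := mul_ne_zero hca0 hdb0
  have hkt : c ^ a * d ^ b ≠ ⊤ := ENNReal.mul_ne_top hcat hdbt
  have hsplit : ∀ u v : ℝ≥0∞, (c⁻¹ * u) ^ a * (d⁻¹ * v) ^ b =
      (c ^ a * d ^ b)⁻¹ * (u ^ a * v ^ b) := by
    intro u v
    rw [ENNReal.mul_rpow_of_nonneg _ _ ha.le, ENNReal.mul_rpow_of_nonneg _ _ hb.le,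
      ENNReal.inv_rpow, ENNReal.inv_rpow, ENNReal.mul_inv (Or.inl hca0) (Or.inl hcat)]
    ring
  have main := lintegral_add_lintegral_le_of_rpow_mul_rpow_le ha hb hab (hf.const_mul c⁻¹)
    (hg.const_mul d⁻¹) (hh.const_mul (c ^ a * d ^ b)⁻¹)
    (by rw [← ENNReal.mul_iSup, ← hc, ENNReal.inv_mul_cancel hc0 hft])
    (by rw [← ENNReal.mul_iSup, ← hd, ENNReal.inv_mul_cancel hd0 hgt])
    (fun x y => by rw [hsplit]; gcongr; exact H x y)
  have := (ENNReal.rpow_mul_rpow_le_add ha hb hab (∫⁻ x, c⁻¹ * f x) (∫⁻ x, d⁻¹ * g x)).trans main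
  rw [lintegral_const_mul _ hf, lintegral_const_mul _ hg, lintegral_const_mul _ hh, hsplit] at this
  exact (ENNReal.mul_le_mul_iff_right (ENNReal.inv_ne_zero.2 hkt) (ENNReal.inv_ne_top.2 hk0)).1 this

/-- The Prékopa–Leindler inequality holds for the volume measure of `E`. The functions take values in
`[0, ∞]`, so that integrals over the fibres of a product are again admissible functions; `h` is
measurable by assumption, which avoids the sup-convolution of `f` and `g`. -/
def PrekopaLeindler (E : Type*) [AddCommMonoid E] [Module ℝ E] [MeasureSpace E] : Prop :=
  ∀ ⦃a b : ℝ⦄, 0 < a → 0 < b → a + b = 1 → ∀ ⦃f g h : E → ℝ≥0∞⦄,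
    Measurable f → Measurable g → Measurable h →
    (∀ x y, f x ^ a * g y ^ b ≤ h (a • x + b • y)) →
    (∫⁻ x, f x) ^ a * (∫⁻ x, g x) ^ b ≤ ∫⁻ x, h x

theorem lintegral_eq_iSup_lintegral_min_natCast {f : ℝ → ℝ≥0∞} (hf : Measurable f) :
    ∫⁻ x, f x = ⨆ n : ℕ, ∫⁻ x, min (f x) n := by
  rw [← lintegral_iSup (fun n => hf.min measurable_const)
    (fun m n hmn x => min_le_min_left _ (by exact_mod_cast hmn))]
  refine lintegral_congr fun x => ?_
  rw [← inf_iSup_eq, ENNReal.iSup_natCast, inf_top_eq]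

/-- The Prékopa–Leindler inequality on the line, by truncation of `f` and `g`. -/
theorem prekopaLeindler_real : PrekopaLeindler ℝ := by
  intro a b ha hb hab f g h hf hg hh H
  rw [lintegral_eq_iSup_lintegral_min_natCast hf, lintegral_eq_iSup_lintegral_min_natCast hg,
    (ENNReal.monotone_rpow_of_nonneg ha.le).map_iSup_of_continuousAt
      ENNReal.continuous_rpow_const.continuousAt (by simp [ha]),
    (ENNReal.monotone_rpow_of_nonneg hb.le).map_iSup_of_continuousAt
      ENNReal.continuous_rpow_const.continuousAt (by simp [hb])]
  simp only [ENNReal.iSup_mul, ENNReal.mul_iSup, iSup_le_iff]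
  intro n m
  refine lintegral_rpow_mul_lintegral_rpow_le_of_iSup_ne_top ha hb hab (hf.min measurable_const)
    (hg.min measurable_const) hh ?_ ?_ fun x y => (?_ : _ ≤ _).trans (H x y)
  · exact ne_top_of_le_ne_top (ENNReal.natCast_ne_top _) (iSup_le fun x => min_le_right _ _)
  · exact ne_top_of_le_ne_top (ENNReal.natCast_ne_top _) (iSup_le fun x => min_le_right _ _)
  · gcongr <;> exact min_le_left _ _

/-- Tensorization: the inequality on the fibres `F` is the hypothesis of the inequality on `E` for the
functions obtained by integrating over the fibres. -/
theorem PrekopaLeindler.prod {E F : Type*} [AddCommMonoid E] [Module ℝ E] [MeasureSpace E]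
    [AddCommMonoid F] [Module ℝ F] [MeasureSpace F] [SFinite (volume : Measure F)]
    (hE : PrekopaLeindler E) (hF : PrekopaLeindler F) : PrekopaLeindler (E × F) := by
  intro a b ha hb hab f g h hf hg hh H
  rw [Measure.volume_eq_prod, lintegral_prod _ hf.aemeasurable, lintegral_prod _ hg.aemeasurable,
    lintegral_prod _ hh.aemeasurable]
  refine hE ha hb hab hf.lintegral_prod_right' hg.lintegral_prod_right' hh.lintegral_prod_right'
    fun x y => ?_
  exact hF ha hb hab (hf.comp measurable_prodMk_left) (hg.comp measurable_prodMk_left)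
    (hh.comp measurable_prodMk_left) fun x' y' => H (x, x') (y, y')

theorem PrekopaLeindler.of_measurePreserving {E F : Type*} [AddCommMonoid E] [Module ℝ E]
    [MeasureSpace E] [AddCommMonoid F] [Module ℝ F] [MeasureSpace F]
    (hE : PrekopaLeindler E) (e : E →ₗ[ℝ] F) (he : MeasurePreserving e) :
    PrekopaLeindler F := by
  intro a b ha hb hab f g h hf hg hh H
  rw [← he.lintegral_comp hf, ← he.lintegral_comp hg, ← he.lintegral_comp hh]
  refine hE ha hb hab (hf.comp he.measurable) (hg.comp he.measurable) (hh.comp he.measurable)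
    fun x y => ?_
  rw [map_add, map_smul, map_smul]
  exact H _ _

theorem prekopaLeindler_fin (n : ℕ) : PrekopaLeindler (Fin n → ℝ) := by
  induction n with
  | zero =>
    intro a b ha hb hab f g h hf hg hh H
    rw [volume_pi, Measure.pi_of_empty _ 0]
    simpa using H 0 0
  | succ n ih =>
    refine (prekopaLeindler_real.prod ih).of_measurePreserving
      (Fin.consLinearEquiv ℝ (fun _ : Fin (n + 1) => ℝ)).toLinearMap ?_
    have h := (volume_preserving_piFinSuccAbove (fun _ : Fin (n + 1) => ℝ) 0).symm
    have e : ⇑(MeasurableEquiv.piFinSuccAbove (fun _ : Fin (n + 1) => ℝ) 0).symm =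
        ⇑(Fin.consLinearEquiv ℝ (fun _ : Fin (n + 1) => ℝ)).toLinearMap := by
      ext x i
      refine Fin.cases ?_ (fun j => ?_) i <;>
        simp [MeasurableEquiv.piFinSuccAbove, Fin.consLinearEquiv]
    rwa [e] at h

theorem prekopaLeindler_pi (ι : Type*) [Fintype ι] : PrekopaLeindler (ι → ℝ) :=
  (prekopaLeindler_fin (Fintype.card ι)).of_measurePreserving
    (LinearEquiv.funCongrLeft ℝ ℝ (Fintype.equivFin ι)).toLinearMap
    (volume_preserving_arrowCongr' (Fintype.equivFin ι).symm (.refl ℝ) (.id _))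

/-! ### Log-concavity as an inequality between values -/

/-- Log-concavity without the exponent `φ`: the multiplicative form of the convexity of `φ`. -/
theorem isLogConcave_iff {ι : Type*} {g : (ι → ℝ) → ℝ} :
    IsLogConcave g ↔ (∀ x, 0 ≤ g x) ∧ ∀ x y : ι → ℝ, ∀ a b : ℝ, 0 < a → 0 < b → a + b = 1 →
      g x ^ a * g y ^ b ≤ g (a • x + b • y) := by
  have exp_combo : ∀ (u v : EReal) (a b : ℝ), 0 < a → 0 < b → u ≠ ⊥ → v ≠ ⊥ →
      EReal.exp (a * u + b * v) = (EReal.exp (-u) ^ a * EReal.exp (-v) ^ b)⁻¹ := by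
    intro u v a b ha hb hu hv
    have h : ∀ (w : EReal) (c : ℝ), 0 < c → w ≠ ⊥ → EReal.exp (-w) ^ c ≠ ⊤ := fun w c hc hw =>
      ENNReal.rpow_ne_top_of_nonneg hc.le (by simpa using hw)
    rw [ENNReal.mul_inv (.inr (h v b hb hv)) (.inl (h u a ha hu)), EReal.exp_add,
      mul_comm (a : EReal), mul_comm (b : EReal), EReal.exp_mul, EReal.exp_mul, EReal.exp_neg,
      EReal.exp_neg, ENNReal.inv_rpow, ENNReal.inv_rpow, inv_inv, inv_inv]
  constructor
  · rintro ⟨φ, hbot, hconv, hg⟩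
    have htop : ∀ x, EReal.exp (-φ x) ≠ ⊤ := fun x => by simpa using hbot x
    refine ⟨fun x => hg x ▸ ENNReal.toReal_nonneg, fun x y a b ha hb hab => ?_⟩
    have h := EReal.exp_monotone (hconv x y a b ha hb hab)
    rw [exp_combo _ _ _ _ ha hb (hbot x) (hbot y), ENNReal.le_inv_iff_le_inv, ← EReal.exp_neg] at h
    rw [hg, hg, hg, ENNReal.toReal_rpow, ENNReal.toReal_rpow, ← ENNReal.toReal_mul]
    exact ENNReal.toReal_mono (htop _) h
  · rintro ⟨h0, hg⟩
    have hbot : ∀ x, -ENNReal.log (ENNReal.ofReal (g x)) ≠ ⊥ := fun x => by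
      rw [Ne, EReal.neg_eq_bot_iff, ENNReal.log_eq_top_iff]
      exact ENNReal.ofReal_ne_top
    refine ⟨fun x => -ENNReal.log (ENNReal.ofReal (g x)), hbot, fun x y a b ha hb hab => ?_,
      fun x => by rw [neg_neg, ENNReal.exp_log, ENNReal.toReal_ofReal (h0 x)]⟩
    rw [← EReal.exp_le_exp_iff, exp_combo _ _ _ _ ha hb (hbot x) (hbot y), EReal.exp_neg,
      ENNReal.inv_le_inv]
    simp only [neg_neg, ENNReal.exp_log]
    rw [ENNReal.ofReal_rpow_of_nonneg (h0 x) ha.le, ENNReal.ofReal_rpow_of_nonneg (h0 y) hb.le,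
      ← ENNReal.ofReal_mul (Real.rpow_nonneg (h0 x) a)]
    exact ENNReal.ofReal_le_ofReal (hg x y a b ha hb hab)

/-! ### Precision forms and strongly log-concave functions -/

section StrongLogConcavity

variable {ι κ : Type*} [Fintype ι] [DecidableEq ι] [Fintype κ] [DecidableEq κ]

/-- The quadratic form `xᵀ S⁻¹ x` of the precision matrix `S⁻¹`. -/
noncomputable def precisionForm (S : Matrix ι ι ℝ) (x : ι → ℝ) : ℝ := x ⬝ᵥ (S⁻¹ *ᵥ x)

theorem precisionForm_nonneg {S : Matrix ι ι ℝ} (hS : S.PosDef) (x : ι → ℝ) :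
    0 ≤ precisionForm S x := by
  simpa [precisionForm] using hS.inv.posSemidef.dotProduct_mulVec_nonneg x

theorem dotProduct_mulVec_comm_of_isHermitian {ι : Type*} [Fintype ι] {M : Matrix ι ι ℝ}
    (hM : M.IsHermitian)
    (x y : ι → ℝ) : x ⬝ᵥ (M *ᵥ y) = y ⬝ᵥ (M *ᵥ x) := by
  have h : Mᵀ = M := by simpa using hM.eq
  rw [Matrix.dotProduct_mulVec, ← Matrix.mulVec_transpose, h, dotProduct_comm]

theorem precisionForm_convex_combination {S : Matrix ι ι ℝ} (hS : S.PosDef) {a b : ℝ}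
    (hab : a + b = 1) (x y : ι → ℝ) :
    a * precisionForm S x + b * precisionForm S y - precisionForm S (a • x + b • y) =
      a * b * precisionForm S (x - y) := by
  have h := dotProduct_mulVec_comm_of_isHermitian hS.inv.isHermitian y x
  simp only [precisionForm, Matrix.mulVec_add, Matrix.mulVec_sub, Matrix.mulVec_smul,
    dotProduct_add, add_dotProduct, dotProduct_sub, sub_dotProduct, dotProduct_smul,
    smul_dotProduct, smul_eq_mul, h]
  obtain rfl : b = 1 - a := by linarith
  ring

/-- The infimal convolution of the precision forms of `S` and `T` dominates the precision form of
`S + T`. With `w = (S + T)⁻¹ (x + y)`, the difference of the two sides is the sum of the values of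
the forms of `S` and `T` at `x - S w` and `y - T w`. -/
theorem precisionForm_add_le {S T : Matrix ι ι ℝ} (hS : S.PosDef) (hT : T.PosDef) (x y : ι → ℝ) :
    precisionForm (S + T) (x + y) ≤ precisionForm S x + precisionForm T y := by
  set w := (S + T)⁻¹ *ᵥ (x + y) with hw
  have key : ∀ {M : Matrix ι ι ℝ} (hM : M.PosDef) (u : ι → ℝ),
      precisionForm M (u - M *ᵥ w) = precisionForm M u - 2 * (u ⬝ᵥ w) + w ⬝ᵥ (M *ᵥ w) := by
    intro M hM u
    have hdet : IsUnit M.det := hM.det_pos.ne'.isUnit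
    have h1 : M⁻¹ *ᵥ (M *ᵥ w) = w := by
      rw [Matrix.mulVec_mulVec, Matrix.nonsing_inv_mul _ hdet, Matrix.one_mulVec]
    have h2 := dotProduct_mulVec_comm_of_isHermitian hM.inv.isHermitian (M *ᵥ w) u
    rw [h1] at h2
    simp only [precisionForm, Matrix.mulVec_sub, dotProduct_sub, sub_dotProduct, h1, h2]
    rw [dotProduct_comm (M *ᵥ w) w]
    ring
  have h1 := precisionForm_nonneg hS (x - S *ᵥ w)
  have h2 := precisionForm_nonneg hT (y - T *ᵥ w)
  rw [key hS] at h1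
  rw [key hT] at h2
  have h3 : w ⬝ᵥ (S *ᵥ w) + w ⬝ᵥ (T *ᵥ w) = precisionForm (S + T) (x + y) := by
    rw [← dotProduct_add, ← Matrix.add_mulVec, hw, Matrix.mulVec_mulVec,
      Matrix.mul_nonsing_inv _ (hS.add hT).det_pos.ne'.isUnit, Matrix.one_mulVec, dotProduct_comm,
      precisionForm]
  have h4 : x ⬝ᵥ w + y ⬝ᵥ w = precisionForm (S + T) (x + y) := by
    rw [← add_dotProduct, hw, precisionForm]
  linarith

/-- Strong log-concavity with covariance `S` as an inequality between values of `f`: the log-concavity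
inequality of `f`, improved by the factor that a Gaussian density of covariance `S` gains. -/
def StronglyLogConcave (S : Matrix ι ι ℝ) (f : (ι → ℝ) → ℝ) : Prop :=
  (∀ x, 0 ≤ f x) ∧ ∀ x y : ι → ℝ, ∀ a b : ℝ, 0 < a → 0 < b → a + b = 1 →
    f x ^ a * f y ^ b * Real.exp (a * b / 2 * precisionForm S (x - y)) ≤ f (a • x + b • y)

theorem gaussianDensity_pos {S : Matrix ι ι ℝ} (hS : S.PosDef) (x : ι → ℝ) :
    0 < gaussianDensity 0 S x := by
  have := hS.det_pos
  unfold gaussianDensity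
  positivity

/-- The Gaussian density attains equality in the defining inequality of `StronglyLogConcave`. -/
theorem gaussianDensity_rpow_mul_rpow {S : Matrix ι ι ℝ} (hS : S.PosDef) {a b : ℝ}
    (hab : a + b = 1) (x y : ι → ℝ) :
    gaussianDensity 0 S x ^ a * gaussianDensity 0 S y ^ b *
      Real.exp (a * b / 2 * precisionForm S (x - y)) = gaussianDensity 0 S (a • x + b • y) := by
  have h : ∀ z, gaussianDensity 0 S z = (Real.sqrt ((2 * Real.pi) ^ Fintype.card ι * S.det))⁻¹ *
      Real.exp (-(1 / 2) * precisionForm S z) := fun z => by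
    rw [gaussianDensity, sub_zero, precisionForm]
  have hk : 0 < (Real.sqrt ((2 * Real.pi) ^ Fintype.card ι * S.det))⁻¹ := by
    have := hS.det_pos
    positivity
  simp only [h]
  set k := (Real.sqrt ((2 * Real.pi) ^ Fintype.card ι * S.det))⁻¹
  have hc := precisionForm_convex_combination hS hab x y
  have hkk : k ^ a * k ^ b = k := by rw [← Real.rpow_add hk, hab, Real.rpow_one]
  rw [Real.mul_rpow hk.le (Real.exp_pos _).le, Real.mul_rpow hk.le (Real.exp_pos _).le,
    ← Real.exp_mul, ← Real.exp_mul]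
  calc _ = (k ^ a * k ^ b) * (Real.exp (-(1 / 2) * precisionForm S x * a) *
        Real.exp (-(1 / 2) * precisionForm S y * b) *
        Real.exp (a * b / 2 * precisionForm S (x - y))) := by ring
    _ = _ := by
      rw [hkk, ← Real.exp_add, ← Real.exp_add]
      congr 2
      linarith

/-- A function is a log-concave multiple of the Gaussian density exactly when it satisfies the
inequality of `StronglyLogConcave`, as the Gaussian density does so with equality. -/
theorem exists_isLogConcave_mul_gaussianDensity_iff {S : Matrix ι ι ℝ} (hS : S.PosDef)
    {f : (ι → ℝ) → ℝ} :
    (∃ g : (ι → ℝ) → ℝ, IsLogConcave g ∧ ∀ x, f x = g x * gaussianDensity 0 S x) ↔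
      StronglyLogConcave S f := by
  have hφ := gaussianDensity_pos hS
  have split : ∀ g : (ι → ℝ) → ℝ, (∀ x, 0 ≤ g x) → ∀ x y a b, a + b = 1 →
      (g x * gaussianDensity 0 S x) ^ a * (g y * gaussianDensity 0 S y) ^ b *
        Real.exp (a * b / 2 * precisionForm S (x - y)) =
      g x ^ a * g y ^ b * gaussianDensity 0 S (a • x + b • y) := by
    intro g hg x y a b hab
    rw [← gaussianDensity_rpow_mul_rpow hS hab, Real.mul_rpow (hg x) (hφ x).le,
      Real.mul_rpow (hg y) (hφ y).le]
    ring
  constructor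
  · rintro ⟨g, hg, hf⟩
    obtain ⟨h0, hg⟩ := isLogConcave_iff.1 hg
    refine ⟨fun x => hf x ▸ mul_nonneg (h0 x) (hφ x).le, fun x y a b ha hb hab => ?_⟩
    rw [hf, hf, hf, split g h0 x y a b hab]
    exact mul_le_mul_of_nonneg_right (hg x y a b ha hb hab) (hφ _).le
  · rintro ⟨h0, hf⟩
    have hfg : ∀ x, f x = f x / gaussianDensity 0 S x * gaussianDensity 0 S x := fun x =>
      (div_mul_cancel₀ _ (hφ x).ne').symm
    have hg0 : ∀ x, 0 ≤ f x / gaussianDensity 0 S x := fun x => div_nonneg (h0 x) (hφ x).le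
    refine ⟨fun x => f x / gaussianDensity 0 S x, isLogConcave_iff.2 ⟨hg0,
      fun x y a b ha hb hab => ?_⟩, hfg⟩
    have h := hf x y a b ha hb hab
    rw [hfg x, hfg y, split _ hg0 x y a b hab] at h
    exact (le_div_iff₀ (hφ _)).2 h

namespace StronglyLogConcave

variable {S T : Matrix ι ι ℝ} {p q : (ι → ℝ) → ℝ}

theorem comp_inv_mulVec (hp : StronglyLogConcave S p) (A : Matrix ι ι ℝ) {c : ℝ}
    (hc : 0 ≤ c) :
    StronglyLogConcave (A * S * Aᵀ) fun y => p (A⁻¹ *ᵥ y) * c := by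
  refine ⟨fun x => mul_nonneg (hp.1 _) hc, fun x y a b ha hb hab => ?_⟩
  have hQ : precisionForm (A * S * Aᵀ) (x - y) = precisionForm S (A⁻¹ *ᵥ x - A⁻¹ *ᵥ y) := by
    rw [← Matrix.mulVec_sub, precisionForm, precisionForm, Matrix.mul_inv_rev, Matrix.mul_inv_rev,
      ← Matrix.transpose_nonsing_inv, ← Matrix.mulVec_mulVec, ← Matrix.mulVec_mulVec,
      Matrix.dotProduct_mulVec, Matrix.vecMul_transpose]
  have hcc : c ^ a * c ^ b = c := by
    rw [← Real.rpow_add_of_nonneg hc ha.le hb.le, hab, Real.rpow_one]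
  have h := hp.2 (A⁻¹ *ᵥ x) (A⁻¹ *ᵥ y) a b ha hb hab
  rw [Real.mul_rpow (hp.1 _) hc, Real.mul_rpow (hp.1 _) hc, hQ]
  simp only [Matrix.mulVec_add, Matrix.mulVec_smul]
  calc _ = p (A⁻¹ *ᵥ x) ^ a * p (A⁻¹ *ᵥ y) ^ b *
        Real.exp (a * b / 2 * precisionForm S (A⁻¹ *ᵥ x - A⁻¹ *ᵥ y)) * (c ^ a * c ^ b) := by ring
    _ ≤ _ := by
      rw [hcc]
      exact mul_le_mul_of_nonneg_right h hc

/-- The product of two strongly log-concave functions of separate variables is strongly log-concave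
for the sum of the precision forms. -/
theorem rpow_mul_rpow_mul_exp_le {p : (ι → ℝ) → ℝ} {q : (κ → ℝ) → ℝ} {T : Matrix κ κ ℝ}
    (hp : StronglyLogConcave S p) (hq : StronglyLogConcave T q) (x y : ι → ℝ) (u v : κ → ℝ)
    {a b : ℝ} (ha : 0 < a) (hb : 0 < b) (hab : a + b = 1) :
    (p x * q u) ^ a * (p y * q v) ^ b *
        Real.exp (a * b / 2 * (precisionForm S (x - y) + precisionForm T (u - v))) ≤
      p (a • x + b • y) * q (a • u + b • v) := by
  have h := mul_le_mul (hp.2 x y a b ha hb hab) (hq.2 u v a b ha hb hab)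
    (mul_nonneg (mul_nonneg (Real.rpow_nonneg (hq.1 u) a) (Real.rpow_nonneg (hq.1 v) b))
      (Real.exp_pos _).le) (hp.1 _)
  rw [Real.mul_rpow (hp.1 x) (hq.1 u), Real.mul_rpow (hp.1 y) (hq.1 v), mul_add, Real.exp_add]
  linarith

theorem mul (hS : S.PosDef) (hT : T.PosDef) (hp : StronglyLogConcave S p)
    (hq : StronglyLogConcave T q) :
    StronglyLogConcave (S⁻¹ + T⁻¹)⁻¹ fun x => p x * q x := by
  refine ⟨fun x => mul_nonneg (hp.1 x) (hq.1 x), fun x y a b ha hb hab => ?_⟩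
  have hQ : precisionForm (S⁻¹ + T⁻¹)⁻¹ (x - y) =
      precisionForm S (x - y) + precisionForm T (x - y) := by
    rw [precisionForm, Matrix.nonsing_inv_nonsing_inv _ (hS.inv.add hT.inv).det_pos.ne'.isUnit,
      Matrix.add_mulVec, dotProduct_add, precisionForm, precisionForm]
  rw [hQ]
  exact rpow_mul_rpow_mul_exp_le hp hq x y x y ha hb hab

theorem sum_prod {T : Matrix κ κ ℝ} {q : (κ → ℝ) → ℝ} (hS : S.PosDef) (hT : T.PosDef)
    (hp : StronglyLogConcave S p) (hq : StronglyLogConcave T q) :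
    StronglyLogConcave (Matrix.fromBlocks S 0 0 T) fun z : ι ⊕ κ → ℝ =>
      p (fun i => z (Sum.inl i)) * q (fun j => z (Sum.inr j)) := by
  refine ⟨fun z => mul_nonneg (hp.1 _) (hq.1 _), fun x y a b ha hb hab => ?_⟩
  have hQ : ∀ z : ι ⊕ κ → ℝ, precisionForm (Matrix.fromBlocks S 0 0 T) z =
      precisionForm S (fun i => z (Sum.inl i)) + precisionForm T (fun j => z (Sum.inr j)) := by
    intro z
    rw [precisionForm, Matrix.inv_fromBlocks_zero₂₁_of_isUnit_iff _ _ _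
      (iff_of_true hS.isUnit hT.isUnit), Matrix.fromBlocks_mulVec, dotProduct]
    simp [Fintype.sum_sum_type, precisionForm, dotProduct, Function.comp_def]
  rw [hQ]
  exact rpow_mul_rpow_mul_exp_le hp hq (fun i => x (Sum.inl i)) (fun i => y (Sum.inl i))
    (fun j => x (Sum.inr j)) (fun j => y (Sum.inr j)) ha hb hab

/-- The integrand `(x, z) ↦ p x * q (z - x)` gains the exponential factor of
`precisionForm S x + precisionForm T (z - x)`, which is at least that of `precisionForm (S + T) z`.
The latter does not involve `x`, so it passes through the Prékopa–Leindler inequality in `x`. -/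
theorem convolution (hS : S.PosDef) (hT : T.PosDef) (hp : StronglyLogConcave S p)
    (hq : StronglyLogConcave T q) (hpm : Measurable p) (hqm : Measurable q)
    (hex : ∀ z, Integrable fun x => p x * q (z - x)) :
    StronglyLogConcave (S + T) fun z => ∫ x, p x * q (z - x) := by
  have hnn : ∀ z x, 0 ≤ p x * q (z - x) := fun z x => mul_nonneg (hp.1 _) (hq.1 _)
  have hi : ∀ z, 0 ≤ ∫ x, p x * q (z - x) := fun z => integral_nonneg (hnn z)
  refine ⟨hi, fun z w a b ha hb hab => ?_⟩
  set e := a * b / 2 * precisionForm (S + T) (z - w) with he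
  have hm : ∀ z, Measurable fun x => ENNReal.ofReal (p x * q (z - x)) := fun z => by fun_prop
  have hL : ∀ z, ∫⁻ x, ENNReal.ofReal (p x * q (z - x)) =
      ENNReal.ofReal (∫ x, p x * q (z - x)) := fun z =>
    (ofReal_integral_eq_lintegral_ofReal (hex z) (ae_of_all _ (hnn z))).symm
  have main := prekopaLeindler_pi ι ha hb hab (hm z) (hm w)
    ((hm (a • z + b • w)).const_mul (ENNReal.ofReal (Real.exp (-e)))) fun x y => by
      rw [ENNReal.ofReal_rpow_of_nonneg (hnn _ _) ha.le,
        ENNReal.ofReal_rpow_of_nonneg (hnn _ _) hb.le,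
        ← ENNReal.ofReal_mul (Real.rpow_nonneg (hnn _ _) _),
        ← ENNReal.ofReal_mul (Real.exp_pos _).le]
      refine ENNReal.ofReal_le_ofReal ?_
      have h := rpow_mul_rpow_mul_exp_le hp hq x y (z - x) (w - y) ha hb hab
      have hz : a • (z - x) + b • (w - y) = a • z + b • w - (a • x + b • y) := by
        rw [smul_sub, smul_sub]; abel
      have hQ := precisionForm_add_le hS hT (x - y) (z - x - (w - y))
      rw [show x - y + (z - x - (w - y)) = z - w by abel] at hQ
      rw [hz] at h
      rw [Real.exp_neg, inv_mul_eq_div, le_div_iff₀ (Real.exp_pos _)]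
      refine le_trans ?_ h
      refine mul_le_mul_of_nonneg_left (Real.exp_le_exp.2 ?_)
        (mul_nonneg (Real.rpow_nonneg (hnn _ _) _) (Real.rpow_nonneg (hnn _ _) _))
      exact mul_le_mul_of_nonneg_left hQ (by positivity)
  rw [lintegral_const_mul _ (hm _), hL, hL, hL, ENNReal.ofReal_rpow_of_nonneg (hi _) ha.le,
    ENNReal.ofReal_rpow_of_nonneg (hi _) hb.le, ← ENNReal.ofReal_mul (Real.rpow_nonneg (hi _) _),
    ← ENNReal.ofReal_mul (Real.exp_pos _).le,
    ENNReal.ofReal_le_ofReal_iff (mul_nonneg (Real.exp_pos _).le (hi _)),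
    Real.exp_neg, inv_mul_eq_div, le_div_iff₀ (Real.exp_pos _)] at main
  exact main

/-- A strongly log-concave function with finite nonzero integral is bounded. Integrating
`p(x)^(1/2) p(y)^(1/2) ≤ p((x + y) / 2)` over `y` bounds `p(x)^(1/2)` times the positive integral of
`p^(1/2)` by a multiple of the integral of `p`. -/
theorem exists_forall_le (hS : S.PosDef) (hp : StronglyLogConcave S p) (hpm : Measurable p)
    (hfin : ∫⁻ x, ENNReal.ofReal (p x) ≠ ⊤) (hpos : ∫⁻ x, ENNReal.ofReal (p x) ≠ 0) :
    ∃ C, ∀ x, p x ≤ C := by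
  set F : (ι → ℝ) → ℝ≥0∞ := fun x => ENNReal.ofReal (p x) with hF
  have hFm : Measurable F := by fun_prop
  set I := ∫⁻ y, F y ^ (1 / 2 : ℝ) with hI
  have hI0 : I ≠ 0 := by
    rw [hI, Ne, lintegral_eq_zero_iff (by fun_prop)]
    rw [Ne, lintegral_eq_zero_iff hFm] at hpos
    refine fun h => hpos ?_
    filter_upwards [h] with x hx
    exact (ENNReal.rpow_eq_zero_iff_of_pos (by norm_num)).1 hx
  set J := ENNReal.ofReal |((1 / 2 : ℝ) ^ Module.finrank ℝ (ι → ℝ))⁻¹| * ∫⁻ x, F x with hJ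
  have hJt : J ≠ ⊤ := ENNReal.mul_ne_top ENNReal.ofReal_ne_top hfin
  have mid : ∀ x y, F x ^ (1 / 2 : ℝ) * F y ^ (1 / 2 : ℝ) ≤
      F ((1 / 2 : ℝ) • x + (1 / 2 : ℝ) • y) := by
    intro x y
    have h := hp.2 x y (1 / 2) (1 / 2) (by norm_num) (by norm_num) (by norm_num)
    rw [hF, ENNReal.ofReal_rpow_of_nonneg (hp.1 x) (by norm_num),
      ENNReal.ofReal_rpow_of_nonneg (hp.1 y) (by norm_num),
      ← ENNReal.ofReal_mul (Real.rpow_nonneg (hp.1 x) _)]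
    refine ENNReal.ofReal_le_ofReal (le_trans (le_mul_of_one_le_right ?_ ?_) h)
    · exact mul_nonneg (Real.rpow_nonneg (hp.1 x) _) (Real.rpow_nonneg (hp.1 y) _)
    · refine Real.one_le_exp (mul_nonneg (by norm_num) (precisionForm_nonneg hS _))
  have bound : ∀ x, F x ^ (1 / 2 : ℝ) * I ≤ J := by
    intro x
    calc F x ^ (1 / 2 : ℝ) * I = ∫⁻ y, F x ^ (1 / 2 : ℝ) * F y ^ (1 / 2 : ℝ) :=
          (lintegral_const_mul _ (by fun_prop)).symm
      _ ≤ ∫⁻ y, F ((1 / 2 : ℝ) • x + (1 / 2 : ℝ) • y) := lintegral_mono (mid x)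
      _ = ∫⁻ y, F ((1 / 2 : ℝ) • x + y) ∂(Measure.map ((1 / 2 : ℝ) • ·) volume) :=
          (lintegral_map (f := fun y => F ((1 / 2 : ℝ) • x + y)) (by fun_prop) (by fun_prop)).symm
      _ = J := by
          rw [Measure.map_addHaar_smul _ (by norm_num), lintegral_smul_measure,
            lintegral_add_left_eq_self, smul_eq_mul]
  refine ⟨((J / I) ^ (2 : ℝ)).toReal, fun x => ?_⟩
  have hle : F x ≤ (J / I) ^ (2 : ℝ) := by
    have hx : F x ^ (1 / 2 : ℝ) ≤ J / I :=
      (ENNReal.le_div_iff_mul_le (.inl hI0) (.inr hJt)).2 (bound x)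
    calc F x = (F x ^ (1 / 2 : ℝ)) ^ (2 : ℝ) := by rw [← ENNReal.rpow_mul]; norm_num
      _ ≤ _ := ENNReal.rpow_le_rpow hx (by norm_num)
  exact (ENNReal.ofReal_le_iff_le_toReal (ENNReal.rpow_ne_top_of_nonneg (by norm_num)
    (ENNReal.div_ne_top hJt hI0))).1 hle

end StronglyLogConcave

/-! ### Densities and laws -/

/-- The measure on `ℝ^ι` with Lebesgue density `p`; negative values of `p` count as zero. -/
noncomputable def densityMeasure {ι : Type*} [Fintype ι] (p : (ι → ℝ) → ℝ) : Measure (ι → ℝ) :=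
  volume.withDensity fun x => ENNReal.ofReal (p x)

theorem densityMeasure_univ {ι : Type*} [Fintype ι] (p : (ι → ℝ) → ℝ) :
    densityMeasure p Set.univ = ∫⁻ x, ENNReal.ofReal (p x) := by
  rw [densityMeasure, withDensity_apply _ MeasurableSet.univ, setLIntegral_univ]

theorem mem_SLC2Fun_iff {S : Matrix ι ι ℝ} {f : (ι → ℝ) → ℝ} :
    f ∈ SLC2Fun 0 S ↔
      S.PosDef ∧ Measurable f ∧ Integrable f volume ∧ StronglyLogConcave S f := by
  refine and_congr_right fun hS => ?_
  rw [exists_isLogConcave_mul_gaussianDensity_iff hS]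

/-- Membership in `SLC2`, with integrability and total integral `1` expressed by the measure. -/
theorem mem_SLC2_iff {S : Matrix ι ι ℝ} {p : (ι → ℝ) → ℝ} :
    p ∈ SLC2 0 S ↔ S.PosDef ∧ Measurable p ∧ IsProbabilityMeasure (densityMeasure p) ∧
      StronglyLogConcave S p := by
  have key : Measurable p → StronglyLogConcave S p →
      ((Integrable p ∧ ∫ x, p x = 1) ↔ IsProbabilityMeasure (densityMeasure p)) := by
    intro hpm hp
    have h0 : 0 ≤ᵐ[volume] p := ae_of_all _ hp.1
    rw [isProbabilityMeasure_iff, densityMeasure_univ]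
    constructor
    · rintro ⟨hi, h1⟩
      rw [← ofReal_integral_eq_lintegral_ofReal hi h0, h1, ENNReal.ofReal_one]
    · intro h
      refine ⟨⟨hpm.aestronglyMeasurable, ?_⟩, ?_⟩
      · rw [hasFiniteIntegral_iff_ofReal h0, h]
        exact ENNReal.one_lt_top
      · rw [integral_eq_lintegral_of_nonneg_ae h0 hpm.aestronglyMeasurable, h, ENNReal.toReal_one]
  change p ∈ SLC2Fun 0 S ∧ _ ↔ _
  rw [mem_SLC2Fun_iff]
  constructor
  · rintro ⟨⟨hS, hpm, hi, hp⟩, h1⟩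
    exact ⟨hS, hpm, (key hpm hp).1 ⟨hi, h1⟩, hp⟩
  · rintro ⟨hS, hpm, hprob, hp⟩
    obtain ⟨hi, h1⟩ := (key hpm hp).2 hprob
    exact ⟨⟨hS, hpm, hi, hp⟩, h1⟩

theorem exists_forall_le_of_mem_SLC2 {S : Matrix ι ι ℝ} {p : (ι → ℝ) → ℝ} (hp : p ∈ SLC2 0 S) :
    ∃ C, ∀ x, ‖p x‖ ≤ C := by
  obtain ⟨hS, hpm, hprob, hslc⟩ := mem_SLC2_iff.1 hp
  have h1 : ∫⁻ x, ENNReal.ofReal (p x) = 1 := by rw [← densityMeasure_univ, measure_univ]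
  obtain ⟨C, hC⟩ := hslc.exists_forall_le hS hpm (by simp [h1]) (by simp [h1])
  exact ⟨C, fun x => by rw [Real.norm_of_nonneg (hslc.1 x)]; exact hC x⟩

theorem map_mulVec_densityMeasure {p : (ι → ℝ) → ℝ} (hp0 : ∀ x, 0 ≤ p x) (hpm : Measurable p)
    {A : Matrix ι ι ℝ} (hA : IsUnit A.det) :
    (densityMeasure p).map (fun x => A *ᵥ x) =
      densityMeasure fun y => p (A⁻¹ *ᵥ y) * |(A⁻¹).det| := by
  have hAm : ∀ B : Matrix ι ι ℝ, Measurable fun x => B *ᵥ x := fun B =>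
    (Continuous.matrix_mulVec continuous_const continuous_id).measurable
  have hmap := Real.map_matrix_volume_pi_eq_smul_volume_pi hA.ne_zero
  have hdet : A.det⁻¹ = (A⁻¹).det := by rw [Matrix.det_nonsing_inv, Ring.inverse_eq_inv']
  ext s hs
  have hpA : Measurable fun y => p (A⁻¹ *ᵥ y) := hpm.comp (hAm _)
  calc (densityMeasure p).map (fun x => A *ᵥ x) s
      = ∫⁻ x in Matrix.toLin' A ⁻¹' s, ENNReal.ofReal (p (A⁻¹ *ᵥ (Matrix.toLin' A x))) := by
        rw [Measure.map_apply (hAm A) hs, densityMeasure, withDensity_apply _ (hAm A hs)]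
        refine lintegral_congr fun x => ?_
        rw [Matrix.toLin'_apply, Matrix.mulVec_mulVec, Matrix.nonsing_inv_mul _ hA,
          Matrix.one_mulVec]
    _ = ∫⁻ y in s, ENNReal.ofReal (p (A⁻¹ *ᵥ y)) ∂(Measure.map (Matrix.toLin' A) volume) :=
        (setLIntegral_map hs hpA.ennreal_ofReal (hAm A)).symm
    _ = densityMeasure (fun y => p (A⁻¹ *ᵥ y) * |(A⁻¹).det|) s := by
        rw [hmap, hdet, densityMeasure, withDensity_apply _ hs, Measure.restrict_smul,
          lintegral_smul_measure, smul_eq_mul, mul_comm,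
          ← lintegral_mul_const _ hpA.ennreal_ofReal]
        exact lintegral_congr fun y => (ENNReal.ofReal_mul (hp0 _)).symm

theorem map_sumElim_prod_densityMeasure {ι κ : Type*} [Fintype ι] [Fintype κ]
    {p : (ι → ℝ) → ℝ} {q : (κ → ℝ) → ℝ}
    (hp0 : ∀ x, 0 ≤ p x) (hpm : Measurable p) (hqm : Measurable q) :
    ((densityMeasure p).prod (densityMeasure q)).map (fun z => Sum.elim z.1 z.2) =
      densityMeasure fun z : ι ⊕ κ → ℝ =>
        p (fun i => z (Sum.inl i)) * q (fun j => z (Sum.inr j)) := by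
  have he := volume_measurePreserving_sumPiEquivProdPi_symm fun _ : ι ⊕ κ => ℝ
  have hcoe : ⇑(MeasurableEquiv.sumPiEquivProdPi fun _ : ι ⊕ κ => ℝ).symm =
      fun z : (ι → ℝ) × (κ → ℝ) => Sum.elim z.1 z.2 := by
    funext z i
    cases i <;> rfl
  rw [hcoe] at he
  ext s hs
  rw [Measure.map_apply he.measurable hs, densityMeasure, densityMeasure,
    prod_withDensity hpm.ennreal_ofReal hqm.ennreal_ofReal, densityMeasure,
    withDensity_apply _ (he.measurable hs), withDensity_apply _ hs,
    ← he.setLIntegral_comp_preimage hs (by fun_prop), Measure.volume_eq_prod]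
  exact lintegral_congr fun z => (ENNReal.ofReal_mul (hp0 _)).symm

theorem conv_densityMeasure {ι : Type*} [Fintype ι]
    {p q : (ι → ℝ) → ℝ} (hp0 : ∀ x, 0 ≤ p x) (hq0 : ∀ x, 0 ≤ q x)
    (hpm : Measurable p) (hqm : Measurable q) (hex : ∀ z, Integrable fun x => p x * q (z - x)) :
    densityMeasure p ∗ densityMeasure q = densityMeasure fun z => ∫ x, p x * q (z - x) := by
  rw [densityMeasure, densityMeasure,
    conv_withDensity_eq_lconvolution hpm.ennreal_ofReal hqm.ennreal_ofReal, densityMeasure]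
  congr 1
  funext z
  rw [lconvolution_def, ofReal_integral_eq_lintegral_ofReal (hex z)
    (ae_of_all _ fun x => mul_nonneg (hp0 x) (hq0 _))]
  refine lintegral_congr fun x => ?_
  rw [ENNReal.ofReal_mul (hp0 x), neg_add_eq_sub]

theorem measurable_integral_mul_sub {ι : Type*} [Fintype ι]
    {p q : (ι → ℝ) → ℝ} (hpm : Measurable p) (hqm : Measurable q) :
    Measurable fun z => ∫ x, p x * q (z - x) := by
  refine (StronglyMeasurable.integral_prod_right (f := fun z x => p x * q (z - x)) ?_).measurable
  exact Measurable.stronglyMeasurable (by fun_prop)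

theorem posDef_fromBlocks_diagonal {ι κ : Type*} [Fintype ι] [Fintype κ]
    {S : Matrix ι ι ℝ} {T : Matrix κ κ ℝ} (hS : S.PosDef)
    (hT : T.PosDef) : (Matrix.fromBlocks S 0 0 T).PosDef := by
  refine .of_dotProduct_mulVec_pos (Matrix.IsHermitian.fromBlocks hS.1 (by simp) hT.1)
    fun z hz => ?_
  have hsplit : star z ⬝ᵥ (Matrix.fromBlocks S 0 0 T *ᵥ z) =
      star (z ∘ Sum.inl) ⬝ᵥ (S *ᵥ (z ∘ Sum.inl)) + star (z ∘ Sum.inr) ⬝ᵥ (T *ᵥ (z ∘ Sum.inr)) := by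
    rw [Matrix.fromBlocks_mulVec]
    simp [dotProduct, Fintype.sum_sum_type]
  rw [hsplit]
  by_cases h : z ∘ Sum.inl = 0
  · refine add_pos_of_nonneg_of_pos (hS.posSemidef.dotProduct_mulVec_nonneg _)
      (hT.dotProduct_mulVec_pos fun h' => hz ?_)
    funext i
    cases i with
    | inl i => exact congrFun h i
    | inr j => exact congrFun h' j
  · exact add_pos_of_pos_of_nonneg (hS.dotProduct_mulVec_pos h)
      (hT.posSemidef.dotProduct_mulVec_nonneg _)

end StrongLogConcavity

end PreservationProof

theorem mainTheorem5 {ι κ : Type*} [Fintype ι] [DecidableEq ι] [Fintype κ] [DecidableEq κ]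
    {Ω : Type*} [MeasurableSpace Ω] (P : Measure Ω) [IsProbabilityMeasure P] :
    -- (a) linear transformations
    (∀ (S : Matrix ι ι ℝ) (p : (ι → ℝ) → ℝ) (A : Matrix ι ι ℝ),
      p ∈ SLC2 0 S → IsUnit A.det →
        (fun y => p (A⁻¹ *ᵥ y) * |(A⁻¹).det|) ∈ SLC2 0 (A * S * Aᵀ) ∧
        ∀ X : Ω → ι → ℝ, HasDensity X P p →
          HasDensity (fun ω => A *ᵥ X ω) P (fun y => p (A⁻¹ *ᵥ y) * |(A⁻¹).det|)) ∧
    -- (b) convolution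
    (∀ (S T : Matrix ι ι ℝ) (p q : (ι → ℝ) → ℝ),
      p ∈ SLC2 0 S → q ∈ SLC2 0 T →
        ConvolutionExists p q (ContinuousLinearMap.mul ℝ ℝ) volume ∧
        (p ⋆[ContinuousLinearMap.mul ℝ ℝ, volume] q) ∈ SLC2 0 (S + T) ∧
        ∀ X Y : Ω → ι → ℝ, HasDensity X P p → HasDensity Y P q → IndepFun X Y P →
          HasDensity (fun ω => X ω + Y ω) P (p ⋆[ContinuousLinearMap.mul ℝ ℝ, volume] q)) ∧
    -- (c) product distributions; `ℝ^(m+n)` has its coordinates indexed by `ι ⊕ κ`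
    (∀ (S : Matrix ι ι ℝ) (T : Matrix κ κ ℝ) (p : (ι → ℝ) → ℝ) (q : (κ → ℝ) → ℝ),
      p ∈ SLC2 0 S → q ∈ SLC2 0 T →
        (fun z : ι ⊕ κ → ℝ => p (fun i => z (Sum.inl i)) * q (fun j => z (Sum.inr j))) ∈
          SLC2 0 (Matrix.fromBlocks S 0 0 T) ∧
        ∀ (X : Ω → ι → ℝ) (Y : Ω → κ → ℝ),
          HasDensity X P p → HasDensity Y P q → IndepFun X Y P →
          HasDensity (fun ω => Sum.elim (X ω) (Y ω)) P
            (fun z => p (fun i => z (Sum.inl i)) * q (fun j => z (Sum.inr j)))) ∧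
    -- (d) pointwise products of functions
    (∀ (S T : Matrix ι ι ℝ) (p q : (ι → ℝ) → ℝ),
      p ∈ SLC2 0 S → q ∈ SLC2 0 T →
        (fun x => p x * q x) ∈ SLC2Fun 0 (S⁻¹ + T⁻¹)⁻¹) := by
  refine ⟨fun S p A hp hA => ?_, fun S T p q hp hq => ?_, fun S T p q hp hq => ?_,
    fun S T p q hp hq => ?_⟩
  · obtain ⟨hS, hpm, hprob, hslc⟩ := mem_SLC2_iff.1 hp
    have hAm : ∀ B : Matrix ι ι ℝ, Measurable fun x => B *ᵥ x := fun B =>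
      (Continuous.matrix_mulVec continuous_const continuous_id).measurable
    have hmap := map_mulVec_densityMeasure hslc.1 hpm hA
    refine ⟨mem_SLC2_iff.2 ⟨?_, (hpm.comp (hAm _)).mul_const _, ?_,
      hslc.comp_inv_mulVec A (abs_nonneg _)⟩, fun X hX => ?_⟩
    · simpa using hS.mul_mul_conjTranspose_same
        (Matrix.vecMul_injective_of_isUnit ((Matrix.isUnit_iff_isUnit_det A).2 hA))
    · rw [← hmap]
      exact Measure.isProbabilityMeasure_map (hAm A).aemeasurable
    · exact HasLaw.comp (Y := fun x => A *ᵥ x) ⟨(hAm A).aemeasurable, hmap⟩ hX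
  · obtain ⟨hS, hpm, hp1, hslcp⟩ := mem_SLC2_iff.1 hp
    obtain ⟨hT, hqm, hq1, hslcq⟩ := mem_SLC2_iff.1 hq
    obtain ⟨C, hC⟩ := exists_forall_le_of_mem_SLC2 hq
    have hex : ∀ z, Integrable fun x => p x * q (z - x) := fun z =>
      hp.1.2.2.1.mul_bdd (c := C) (hqm.comp (measurable_const.sub measurable_id)).aestronglyMeasurable
        (ae_of_all _ fun x => hC _)
    have hconv : (p ⋆[ContinuousLinearMap.mul ℝ ℝ, volume] q) = fun z => ∫ x, p x * q (z - x) := rfl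
    have hmeas := conv_densityMeasure hslcp.1 hslcq.1 hpm hqm hex
    rw [hconv]
    refine ⟨hex, mem_SLC2_iff.2 ⟨hS.add hT, measurable_integral_mul_sub hpm hqm, ?_,
      hslcp.convolution hS hT hslcq hpm hqm hex⟩, fun X Y hX hY hXY => ?_⟩
    · rw [← hmeas]
      infer_instance
    · have h := IndepFun.hasLaw_add (μ := densityMeasure p) (ν := densityMeasure q) hX hY hXY
      rw [hmeas] at h
      exact h
  · obtain ⟨hS, hpm, hp1, hslcp⟩ := mem_SLC2_iff.1 hp
    obtain ⟨hT, hqm, hq1, hslcq⟩ := mem_SLC2_iff.1 hq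
    have hmap := map_sumElim_prod_densityMeasure hslcp.1 hpm hqm
    have helim : Measurable fun z : (ι → ℝ) × (κ → ℝ) => (Sum.elim z.1 z.2 : ι ⊕ κ → ℝ) :=
      (MeasurableEquiv.sumPiEquivProdPi fun _ : ι ⊕ κ => ℝ).symm.measurable
    refine ⟨mem_SLC2_iff.2 ⟨posDef_fromBlocks_diagonal hS hT, by fun_prop, ?_,
      hslcp.sum_prod hS hT hslcq⟩, fun X Y hX hY hXY => ?_⟩
    · rw [← hmap]
      exact Measure.isProbabilityMeasure_map helim.aemeasurable
    · refine HasLaw.comp (X := fun ω => (X ω, Y ω)) ⟨helim.aemeasurable, hmap⟩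
        ⟨hX.aemeasurable.prodMk hY.aemeasurable, ?_⟩
      rw [(indepFun_iff_map_prod_eq_prod_map_map hX.aemeasurable hY.aemeasurable).1 hXY,
        hX.map_eq, hY.map_eq]
      rfl
  · obtain ⟨hS, hpm, hp1, hslcp⟩ := mem_SLC2_iff.1 hp
    obtain ⟨hT, hqm, hq1, hslcq⟩ := mem_SLC2_iff.1 hq
    obtain ⟨C, hC⟩ := exists_forall_le_of_mem_SLC2 hq
    exact mem_SLC2Fun_iff.2 ⟨(hS.inv.add hT.inv).inv, hpm.mul hqm,
      hp.1.2.2.1.mul_bdd (c := C) hqm.aestronglyMeasurable (ae_of_all _ hC), hslcp.mul hS hT hslcq⟩
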